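/- **Setting.** Let $p\ge 2$, let $\mathscr X\subseteq\mathbb R^d$, let $\mu$ be a probability measure on $\mathscr X$, and let $\mathscr M$ map each $x\in\mathscr X$ to a symmetric non-negative definite $p\times p$ matrix. Write $\|A\|=\mathrm{tr}^{1/2}(AA^\top)$, and for $0\le\ell\le L$ let $\mathbb M^{\ge}_{\ell,L}$ be the set of symmetric non-negative definite $p\times p$ matrices $A$ with $\ell<\lambda_{\min}(A)$ and $\lambda_{\max}(A)<L$. Assume $H_{\mathscr M}$: (i) $\mathscr M$ is continuous on $\mathscr X$ and $\int_{\mathscr X}\|\mathscr M(x)\|^2\,\mu(dx)<B<\infty$ for some $B$; (ii) for every $\epsilon>0$ there is $\ell_\epsilon>0$ such that $\lambda_{\min}\big(\int_{A}\mathscr M(x)\,\mu(dx)\big)>\ell_\epsilon$ for every measurable $A\subseteq\mathscr X$ with $\mu(A)=\epsilon$. Let $X_1,X_2,\dots$ be i.i.d. with law $\mu$. Let $\Phi$ be a criterion on the symmetric non-negative definite matrices with values in $\mathbb R\cup\{-\infty\}$, with directional derivative $F_\Phi(M,M')=\lim_{t\to0^+}[\Phi((1-t)M+tM')-\Phi(M)]/t$.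 **Algorithm 1.** Constants: $\alpha\in(0,1)$, an integer $k_0\ge p$, $q\in(1/2,1)$, $\gamma\in(0,q-1/2)$ and $0<\epsilon_1<\alpha$. *Initialization.* Select $X_1,\dots,X_{k_0}$, then further points one at a time, increasing $k_0$ by one each time, until $\frac1{k_0}\sum_{i\le k_0}\mathscr M(X_i)$ is nonsingular; from here on $k_0$ denotes the final value, and $n_k=k$, $\mathbf M_{n_k}=\frac1k\sum_{i\le k}\mathscr M(X_i)$ for $1\le k\le k_0$ (for all $k\ge1$ if the initialization never stops). Let $\zeta_i=F_\Phi(\mathbf M_{n_{k_0}},\mathscr M(X_i))$, $i\le k_0$, with order statistics $\zeta_{1:k_0}\le\dots\le\zeta_{k_0:k_0}$; put $k_0^+=\lceil(1-\alpha/2)k_0\rceil$, $k_0^-=\max\{\lfloor(1-3\alpha/2)k_0\rfloor,1\}$, $\widehat C_{k_0}=\zeta_{\lceil(1-\alpha)k_0\rceil:k_0}$, $\beta_0=k_0/(k_0^+-k_0^-)$, $h=\zeta_{k_0^+:k_0}-\zeta_{k_0^-:k_0}$, $h_k=h/k^\gamma$ and $\widehat f_{k_0}=\#\{i\le k_0:|\zeta_i-\widehat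 C_{k_0}|\le h_{k_0}\}/(2k_0h_{k_0})$. *Iteration $k+1$, for $k\ge k_0$.* Let $Z=F_\Phi(\mathbf M_{n_k},\mathscr M(X_{k+1}))$; put $z_{k+1}=+\infty$ if $n_k/k<\epsilon_1$, and $z_{k+1}=Z$ otherwise. If $z_{k+1}\ge\widehat C_k$, select $X_{k+1}$: $n_{k+1}=n_k+1$ and $\mathbf M_{n_{k+1}}=\mathbf M_{n_k}+\frac1{n_k+1}[\mathscr M(X_{k+1})-\mathbf M_{n_k}]$. Otherwise $n_{k+1}=n_k$ and $\mathbf M_{n_{k+1}}=\mathbf M_{n_k}$. In both cases, with $\beta_k=\min\{1/\widehat f_k,\beta_0k^\gamma\}$, $$\widehat C_{k+1}=\widehat C_k+\frac{\beta_k}{(k+1)^q}\big(\mathbb I_{\{Z\ge\widehat C_k\}}-\alpha\big),\qquad \widehat f_{k+1}=\widehat f_k+\frac1{(k+1)^q}\Big[\frac{1}{2h_{k+1}}\mathbb I_{\{|Z-\widehat C_k|\le h_{k+1}\}}-\widehat f_k\Big].$$ **Lemma.** Under $H_{\mathscr M}$ and with the above constants (in particular $\epsilon_1>0$): (a) for every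 realization and every $k\ge1$, $n_{k+1}/k\ge\epsilon_1$; moreover $n_{k+1}/k>\epsilon_1$, except possibly when $n_k/k=\epsilon_1$ exactly and $X_{k+1}$ is not selected; (b) almost surely, the initialization stops (the final $k_0$ is finite) and there exist $\ell>0$ and $L<\infty$ such that $\mathbf M_{n_k}\in\mathbb M^{\ge}_{\ell,L}$ for all $k>k_0$. -/

import Mathlib

open MeasureTheory ProbabilityTheory Filter Topology

namespace SeqDesign

noncomputable section

/-- The smallest eigenvalue of a real symmetric matrix: the minimum of its spectrum,
which is a finite nonempty set of reals as soon as `p ≥ 1`. -/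
def lambdaMin {p : ℕ} (A : Matrix (Fin p) (Fin p) ℝ) : ℝ := sInf (spectrum ℝ A)

/-- The largest eigenvalue of a real symmetric matrix. -/
def lambdaMax {p : ℕ} (A : Matrix (Fin p) (Fin p) ℝ) : ℝ := sSup (spectrum ℝ A)

/-- The set of symmetric non-negative definite matrices `A` with
`ℓ < λ_min(A)` and `λ_max(A) < L`. -/
def boundedCone (p : ℕ) (l L : ℝ) : Set (Matrix (Fin p) (Fin p) ℝ) :=
  {A | A.PosSemidef ∧ l < lambdaMin A ∧ lambdaMax A < L}

/-- The Frobenius norm `tr(A Aᵀ)^(1/2)`. -/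
def frobNorm {p : ℕ} (A : Matrix (Fin p) (Fin p) ℝ) : ℝ := Real.sqrt (A * A.transpose).trace

/-- The matrix-valued integral `∫_A 𝓜(x) μ(dx)`, taken entry by entry. -/
def infoIntegral {S : Type*} [MeasurableSpace S] {p : ℕ} (μ : Measure S)
    (𝓜 : S → Matrix (Fin p) (Fin p) ℝ) (A : Set S) : Matrix (Fin p) (Fin p) ℝ :=
  Matrix.of fun i j => ∫ x in A, 𝓜 x i j ∂μ

/-- The assumption on the elementary information matrices: (i) continuity and a finite second
moment; (ii) the information carried by a set of given positive measure `ε` is bounded below, by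
a constant that depends on `ε` only. -/
structure HypM {S : Type*} [TopologicalSpace S] [MeasurableSpace S] {p : ℕ} (μ : Measure S)
    (𝓜 : S → Matrix (Fin p) (Fin p) ℝ) : Prop where
  cont : Continuous 𝓜
  moment : ∃ B : ℝ, Integrable (fun x => frobNorm (𝓜 x) ^ 2) μ ∧
    ∫ x, frobNorm (𝓜 x) ^ 2 ∂μ < B
  lower : ∀ ε : ℝ, 0 < ε → ∃ l : ℝ, 0 < l ∧ ∀ A : Set S, MeasurableSet A →
    μ A = ENNReal.ofReal ε → l < lambdaMin (infoIntegral μ 𝓜 A)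

/-- The directional derivative of the criterion `Φ`, with values in `ℝ ∪ {-∞}`, at `A` in the
direction `A'`: the limit of `(Φ((1-t) A + t A') - Φ(A)) / t` as `t` decreases to `0`. It is only
used at matrices `A` where `Φ` is finite. -/
def dirDeriv {p : ℕ} (Φ : Matrix (Fin p) (Fin p) ℝ → WithBot ℝ)
    (A A' : Matrix (Fin p) (Fin p) ℝ) : ℝ :=
  limUnder (𝓝[>] (0 : ℝ)) fun t : ℝ =>
    ((Φ ((1 - t) • A + t • A')).unbotD 0 - (Φ A).unbotD 0) / t

/-- The `j`-th smallest (`1 ≤ j ≤ k`) of the `k` numbers `z 0, …, z (k - 1)`, with repetitions. -/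
def orderStat (z : ℕ → ℝ) (k j : ℕ) : ℝ :=
  (((Multiset.range k).map z).sort (· ≤ ·)).getD (j - 1) 0

/-- The average `(1/k) ∑_{i=1}^k 𝓜(x_i)`. Here and below the `i`-th point `x_i` of the data
sequence is `x (i - 1)`, so that `x k` is the point collected at iteration `k + 1`. -/
def meanInfo {S : Type*} {p : ℕ} (𝓜 : S → Matrix (Fin p) (Fin p) ℝ) (x : ℕ → S) (k : ℕ) :
    Matrix (Fin p) (Fin p) ℝ :=
  (1 / (k : ℝ)) • ∑ i ∈ Finset.range k, 𝓜 (x i)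

/-- The tuning constants of the algorithm: `k0` is the value chosen for the size of the initial
sample, before it is possibly increased. -/
structure Params where
  α : ℝ
  k0 : ℕ
  q : ℝ
  γ : ℝ
  ε₁ : ℝ

/-- The constraints that the tuning constants have to satisfy, for `p × p` matrices. -/
structure Params.Valid (P : Params) (p : ℕ) : Prop where
  α_pos : 0 < P.α
  α_lt_one : P.α < 1
  k0_ge : p ≤ P.k0
  q_gt : 1 / 2 < P.q
  q_lt : P.q < 1
  γ_pos : 0 < P.γ
  γ_lt : P.γ < P.q - 1 / 2
  ε₁_pos : 0 < P.ε₁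
  ε₁_lt : P.ε₁ < P.α

/-- The variables of the algorithm after `k` points have been examined: the number `n = n_k` of
selected points, the normalized information matrix `M = M_{n_k}` of the selected points, the
quantile estimate `C`, the density estimate `f`, and the constants `β0` and `h` that are fixed
once for all at the end of the initialization. -/
structure State (p : ℕ) where
  n : ℕ
  M : Matrix (Fin p) (Fin p) ℝ
  C : ℝ
  f : ℝ
  β0 : ℝ
  h : ℝ

section Algorithm

variable {S : Type*} {p : ℕ} (P : Params) (Φ : Matrix (Fin p) (Fin p) ℝ → WithBot ℝ)
  (𝓜 : S → Matrix (Fin p) (Fin p) ℝ) (x : ℕ → S)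

/-- The size of the initial sample actually used: the first `k ≥ k0` for which the average of the
first `k` information matrices is nonsingular (`⊤` if there is none). -/
def startIndex : ℕ∞ :=
  sInf ((fun k : ℕ => (k : ℕ∞)) '' {k : ℕ | P.k0 ≤ k ∧ IsUnit (meanInfo 𝓜 x k).det})

open Classical in
/-- The state when the initialization stops after the first `k` points, all of them selected. -/
def initState (k : ℕ) : State p :=
  let A := meanInfo 𝓜 x k
  let ζ : ℕ → ℝ := fun i => dirDeriv Φ A (𝓜 (x i))
  let kplus : ℕ := ⌈(1 - P.α / 2) * (k : ℝ)⌉₊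
  let kminus : ℕ := max ⌊(1 - 3 * P.α / 2) * (k : ℝ)⌋₊ 1
  let C := orderStat ζ k ⌈(1 - P.α) * (k : ℝ)⌉₊
  let h := orderStat ζ k kplus - orderStat ζ k kminus
  let hk := h / (k : ℝ) ^ P.γ
  { n := k
    M := A
    C := C
    f := (∑ i ∈ Finset.range k, if |ζ i - C| ≤ hk then (1 : ℝ) else 0) / (2 * (k : ℝ) * hk)
    β0 := (k : ℝ) / ((kplus : ℝ) - (kminus : ℝ))
    h := h }

open Classical in
/-- Iteration `k + 1`: the point `x_{k+1}` (that is, `x k`) is examined when the state is `s`. -/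
def step (k : ℕ) (s : State p) : State p :=
  let Z : ℝ := dirDeriv Φ s.M (𝓜 (x k))
  let z : EReal := if (s.n : ℝ) / (k : ℝ) < P.ε₁ then ⊤ else (Z : EReal)
  let β : ℝ := min (1 / s.f) (s.β0 * (k : ℝ) ^ P.γ)
  let hnext : ℝ := s.h / ((k : ℝ) + 1) ^ P.γ
  { n := if (s.C : EReal) ≤ z then s.n + 1 else s.n
    M := if (s.C : EReal) ≤ z then s.M + (1 / ((s.n : ℝ) + 1)) • (𝓜 (x k) - s.M) else s.M
    C := s.C + β / ((k : ℝ) + 1) ^ P.q * ((if s.C ≤ Z then 1 else 0) - P.α)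
    f := s.f + 1 / ((k : ℝ) + 1) ^ P.q *
      (1 / (2 * hnext) * (if |Z - s.C| ≤ hnext then 1 else 0) - s.f)
    β0 := s.β0
    h := s.h }

open Classical in
/-- The state after `k` points. As long as the initialization lasts (`k ≤ startIndex`), every point
is selected; the estimates of the initialization are those computed at `k = startIndex`, the
earlier ones being overwritten. -/
def state : ℕ → State p
  | 0 => initState P Φ 𝓜 x 0
  | k + 1 =>
    if ((k + 1 : ℕ) : ℕ∞) ≤ startIndex P 𝓜 x then initState P Φ 𝓜 x (k + 1)
    else step P Φ 𝓜 x k (state k)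

end Algorithm

end

end SeqDesign

/-! Part (a): a point is rejected only if `n_k / k ≥ ε₁`, since otherwise `z = +∞`. By induction
`n_k ≥ ε₁ (k - 1)`, and a selection then gives `n_k + 1 > ε₁ k` because `ε₁ < 1`.

Part (b): selection is adaptive, so no law of large numbers applies to the selected points. By (a)
they form a fixed fraction of the first `k` points, and `HypM.ae_eventually_le_sum` bounds the
information of every such index set from below. Each direction is informative almost everywhere;
continuity makes this uniform near the direction, off a set of small measure, and compactness of the
sphere leaves finitely many such sets. The strong law limits the visits to each, so most indices of
a large set avoid it. This also stops the initialization. The finitely many remaining `k` are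
covered by positive definiteness, inherited from the initial sample. For the upper bound, the trace
dominates `lambdaMax`, and the selected traces sum to at most the sum over all points, which the
strong law controls. -/

namespace SeqDesign

open Matrix

/-! ### Extreme eigenvalues and quadratic forms. -/

section Spectral

variable {p : ℕ}

/-- The quadratic form of a matrix, evaluated at a Euclidean vector. -/
noncomputable def quadForm (v : EuclideanSpace ℝ (Fin p)) :
    Matrix (Fin p) (Fin p) ℝ →ₗ[ℝ] ℝ where
  toFun A := v.ofLp ⬝ᵥ (A *ᵥ v.ofLp)
  map_add' A B := by rw [add_mulVec, dotProduct_add]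
  map_smul' c A := by rw [smul_mulVec, dotProduct_smul]; rfl

lemma quadForm_apply (v : EuclideanSpace ℝ (Fin p)) (A : Matrix (Fin p) (Fin p) ℝ) :
    quadForm v A = v.ofLp ⬝ᵥ (A *ᵥ v.ofLp) := rfl

lemma quadForm_eq_sum (v : EuclideanSpace ℝ (Fin p)) (A : Matrix (Fin p) (Fin p) ℝ) :
    quadForm v A = ∑ i, ∑ j, v i * (A i j * v j) := by
  simp only [quadForm_apply, dotProduct, mulVec, Finset.mul_sum]

lemma quadForm_nonneg {A : Matrix (Fin p) (Fin p) ℝ} (hA : A.PosSemidef)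
    (v : EuclideanSpace ℝ (Fin p)) : 0 ≤ quadForm v A := by
  simpa [quadForm_apply] using hA.dotProduct_mulVec_nonneg v.ofLp

lemma quadForm_pos {A : Matrix (Fin p) (Fin p) ℝ} (hA : A.PosDef)
    {v : EuclideanSpace ℝ (Fin p)} (hv : v ≠ 0) : 0 < quadForm v A := by
  have : v.ofLp ≠ 0 := by simpa using hv
  simpa [quadForm_apply] using hA.dotProduct_mulVec_pos this

lemma exists_quadForm_eq_eigenvalue {A : Matrix (Fin p) (Fin p) ℝ} (hA : A.IsHermitian)
    (i : Fin p) : ∃ v : EuclideanSpace ℝ (Fin p), ‖v‖ = 1 ∧ hA.eigenvalues i = quadForm v A :=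
  ⟨hA.eigenvectorBasis i, hA.eigenvectorBasis.orthonormal.1 i, by
    simpa [quadForm_apply] using hA.eigenvalues_eq i⟩

lemma le_lambdaMin [NeZero p] {A : Matrix (Fin p) (Fin p) ℝ} (hA : A.IsHermitian) {c : ℝ}
    (h : ∀ v : EuclideanSpace ℝ (Fin p), ‖v‖ = 1 → c ≤ quadForm v A) : c ≤ lambdaMin A := by
  rw [lambdaMin, hA.spectrum_real_eq_range_eigenvalues]
  refine le_csInf (Set.range_nonempty _) ?_
  rintro _ ⟨i, rfl⟩
  obtain ⟨v, hv, h'⟩ := exists_quadForm_eq_eigenvalue hA i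
  exact h'.symm ▸ h v hv

lemma lambdaMin_le_eigenvalues {A : Matrix (Fin p) (Fin p) ℝ} (hA : A.IsHermitian) (i : Fin p) :
    lambdaMin A ≤ hA.eigenvalues i := by
  rw [lambdaMin, hA.spectrum_real_eq_range_eigenvalues]
  exact csInf_le (Set.finite_range _).bddBelow ⟨i, rfl⟩

lemma posDef_of_lambdaMin_pos {A : Matrix (Fin p) (Fin p) ℝ} (hA : A.IsHermitian)
    (h : 0 < lambdaMin A) : A.PosDef :=
  hA.posDef_iff_eigenvalues_pos.2 fun i => h.trans_le (lambdaMin_le_eigenvalues hA i)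

lemma lambdaMin_pos [NeZero p] {A : Matrix (Fin p) (Fin p) ℝ} (hA : A.PosDef) :
    0 < lambdaMin A := by
  have hne : (Set.range hA.1.eigenvalues).Nonempty := Set.range_nonempty _
  rw [lambdaMin, hA.1.spectrum_real_eq_range_eigenvalues]
  obtain ⟨i, hi⟩ := hne.csInf_mem (Set.finite_range _)
  exact hi ▸ hA.eigenvalues_pos i

lemma posDef_of_quadForm_pos {A : Matrix (Fin p) (Fin p) ℝ} (hA : A.IsHermitian)
    (h : ∀ v : EuclideanSpace ℝ (Fin p), ‖v‖ = 1 → 0 < quadForm v A) : A.PosDef := by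
  refine hA.posDef_iff_eigenvalues_pos.2 fun i => ?_
  obtain ⟨v, hv, h'⟩ := exists_quadForm_eq_eigenvalue hA i
  exact h'.symm ▸ h v hv

lemma lambdaMax_le_trace [NeZero p] {A : Matrix (Fin p) (Fin p) ℝ} (hA : A.PosSemidef) :
    lambdaMax A ≤ A.trace := by
  rw [lambdaMax, hA.1.spectrum_real_eq_range_eigenvalues]
  refine csSup_le (Set.range_nonempty _) ?_
  rintro _ ⟨i, rfl⟩
  rw [hA.1.trace_eq_sum_eigenvalues]
  exact Finset.single_le_sum (f := hA.1.eigenvalues) (fun j _ => hA.eigenvalues_nonneg j)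
    (Finset.mem_univ i)

lemma abs_apply_le_frobNorm (A : Matrix (Fin p) (Fin p) ℝ) (i j : Fin p) :
    |A i j| ≤ frobNorm A := by
  refine Real.abs_le_sqrt ?_
  simp only [trace, diag, mul_apply, transpose_apply, ← sq]
  calc A i j ^ 2 ≤ ∑ j, A i j ^ 2 :=
        Finset.single_le_sum (f := fun j => A i j ^ 2) (fun _ _ => sq_nonneg _) (Finset.mem_univ j)
    _ ≤ ∑ i, ∑ j, A i j ^ 2 :=
        Finset.single_le_sum (f := fun i => ∑ j, A i j ^ 2)
          (fun _ _ => Finset.sum_nonneg fun _ _ => sq_nonneg _) (Finset.mem_univ i)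

lemma continuous_quadForm {S : Type*} [TopologicalSpace S]
    {𝓜 : S → Matrix (Fin p) (Fin p) ℝ} (h : Continuous 𝓜) :
    Continuous fun y : EuclideanSpace ℝ (Fin p) × S => quadForm y.1 (𝓜 y.2) := by
  simp only [quadForm_eq_sum]
  fun_prop

lemma isHermitian_infoIntegral {S : Type*} [MeasurableSpace S] {μ : Measure S}
    {𝓜 : S → Matrix (Fin p) (Fin p) ℝ} (h𝓜 : ∀ x, (𝓜 x).PosSemidef) (A : Set S) :
    (infoIntegral μ 𝓜 A).IsHermitian := by
  refine Matrix.IsHermitian.ext fun i j => ?_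
  simp only [infoIntegral, of_apply, star_trivial]
  congr with x
  simpa using (h𝓜 x).1.apply i j

end Spectral

/-! ### Uniform informativeness outside sets of small measure. -/

section Integral

variable {S : Type*} [TopologicalSpace S] [MeasurableSpace S] [OpensMeasurableSpace S] {p : ℕ}
  {μ : Measure S} [IsProbabilityMeasure μ] {𝓜 : S → Matrix (Fin p) (Fin p) ℝ}

lemma HypM.integrable_apply (hM : HypM μ 𝓜) (i j : Fin p) :
    Integrable (fun x => 𝓜 x i j) μ := by
  obtain ⟨B, hB, -⟩ := hM.moment
  have hc : Continuous fun x => 𝓜 x i j := by have := hM.cont; fun_prop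
  refine ((integrable_const (1 : ℝ)).add hB).mono' hc.measurable.aestronglyMeasurable
    (Eventually.of_forall fun x => ?_)
  have := abs_apply_le_frobNorm (𝓜 x) i j
  rw [Real.norm_eq_abs, Pi.add_apply]
  nlinarith [sq_nonneg (frobNorm (𝓜 x) - 1), abs_nonneg (𝓜 x i j)]

lemma HypM.integrable_trace (hM : HypM μ 𝓜) : Integrable (fun x => (𝓜 x).trace) μ :=
  integrable_finsetSum _ fun i _ => hM.integrable_apply i i

lemma HypM.quadForm_infoIntegral (hM : HypM μ 𝓜) (v : EuclideanSpace ℝ (Fin p)) (A : Set S) :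
    quadForm v (infoIntegral μ 𝓜 A) = ∫ x in A, quadForm v (𝓜 x) ∂μ := by
  have hi (i j : Fin p) : Integrable (fun x => v i * (𝓜 x i j * v j)) (μ.restrict A) :=
    (((hM.integrable_apply i j).restrict).mul_const _).const_mul _
  simp only [quadForm_eq_sum, infoIntegral, of_apply]
  rw [integral_finsetSum _ fun i _ => integrable_finsetSum _ fun j _ => hi i j]
  refine Finset.sum_congr rfl fun i _ => ?_
  rw [integral_finsetSum _ fun j _ => hi i j]
  refine Finset.sum_congr rfl fun j _ => ?_
  rw [integral_const_mul, integral_mul_const]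

/-- Every direction is informative at almost every point. -/
lemma HypM.measure_quadForm_nonpos (hM : HypM μ 𝓜) (h𝓜 : ∀ x, (𝓜 x).PosSemidef)
    {v : EuclideanSpace ℝ (Fin p)} (hv : v ≠ 0) : μ {x | quadForm v (𝓜 x) ≤ 0} = 0 := by
  by_contra hne
  set A := {x | quadForm v (𝓜 x) ≤ 0} with hA
  have hcont : Continuous fun x => quadForm v (𝓜 x) :=
    (continuous_quadForm hM.cont).comp (Continuous.prodMk_right v)
  have hAm : MeasurableSet A := (isClosed_le hcont continuous_const).measurableSet
  -- `lower` concerns sets of measure exactly `ε`, so `ε` is taken to be the measure of `A` itself.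
  obtain ⟨l, hl, h⟩ := hM.lower (μ A).toReal (ENNReal.toReal_pos hne (measure_ne_top _ _))
  have hpd := posDef_of_lambdaMin_pos (isHermitian_infoIntegral h𝓜 A)
    (hl.trans (h A hAm (ENNReal.ofReal_toReal (measure_ne_top _ _)).symm))
  have hpos := quadForm_pos hpd hv
  rw [hM.quadForm_infoIntegral] at hpos
  exact hpos.not_ge (setIntegral_nonpos hAm fun x hx => hx)

/-- With `r = 1/(n+1)`, the bad sets `E n` are open, hence measurable despite the uncountable union.
They decrease, and by continuity their intersection lies in the null set where the form at `v` is
nonpositive; continuity of `μ` from above concludes. -/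
lemma HypM.exists_ball (hM : HypM μ 𝓜) (h𝓜 : ∀ x, (𝓜 x).PosSemidef)
    {v : EuclideanSpace ℝ (Fin p)} (hv : v ≠ 0) {ε : ℝ} (hε : 0 < ε) :
    ∃ r > 0, ∃ E : Set S, MeasurableSet E ∧ μ.real E < ε ∧
      ∀ w ∈ Metric.ball v r, ∀ x ∉ E, r ≤ quadForm w (𝓜 x) := by
  set r : ℕ → ℝ := fun n => 1 / ((n : ℝ) + 1)
  have hr (n : ℕ) : 0 < r n := Nat.one_div_pos_of_nat
  have hr0 : Tendsto r atTop (𝓝 0) := tendsto_one_div_add_atTop_nhds_zero_nat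
  have hcont := continuous_quadForm hM.cont
  set E : ℕ → Set S := fun n => ⋃ w ∈ Metric.ball v (r n), {x | quadForm w (𝓜 x) < r n}
  have hE (n : ℕ) : MeasurableSet (E n) :=
    (isOpen_biUnion fun w _ => isOpen_lt (hcont.comp (Continuous.prodMk_right w))
      continuous_const).measurableSet
  have hanti : Antitone E := by
    intro m n hmn x hx
    have hle : r n ≤ r m := Nat.one_div_le_one_div hmn
    simp only [E, Set.mem_iUnion₂, Set.mem_ofPred_eq, exists_prop] at hx ⊢
    obtain ⟨w, hw, hwx⟩ := hx
    exact ⟨w, Metric.ball_subset_ball hle hw, hwx.trans_le hle⟩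
  have hsub : ⋂ n, E n ⊆ {x | quadForm v (𝓜 x) ≤ 0} := by
    intro x hx
    have hx' : ∀ n, ∃ w ∈ Metric.ball v (r n), quadForm w (𝓜 x) < r n := by
      simpa [E] using hx
    choose w hw hwx using hx'
    have hwv : Tendsto w atTop (𝓝 v) :=
      tendsto_iff_dist_tendsto_zero.2 <| squeeze_zero (fun _ => dist_nonneg)
        (fun n => (Metric.mem_ball.1 (hw n)).le) hr0
    have hq : Tendsto (fun n => quadForm (w n) (𝓜 x)) atTop (𝓝 (quadForm v (𝓜 x))) :=
      ((hcont.comp (Continuous.prodMk_left x)).tendsto v).comp hwv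
    exact le_of_tendsto_of_tendsto' hq hr0 fun n => (hwx n).le
  have hlim := tendsto_measure_iInter_atTop (μ := μ) (fun n => (hE n).nullMeasurableSet) hanti
    ⟨0, measure_ne_top _ _⟩
  rw [measure_mono_null hsub (hM.measure_quadForm_nonpos h𝓜 hv)] at hlim
  obtain ⟨n, hn⟩ := (hlim.eventually_lt_const (ENNReal.ofReal_pos.2 hε)).exists
  refine ⟨r n, hr n, E n, hE n, (ENNReal.lt_ofReal_iff_toReal_lt (measure_ne_top _ _)).1 hn, ?_⟩
  intro w hw x hx
  by_contra! hlt
  exact hx (Set.mem_iUnion₂.2 ⟨w, hw, hlt⟩)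

/-- Finitely many exceptional sets of small measure suffice for all directions. -/
lemma HypM.exists_finite_cover (hM : HypM μ 𝓜) (h𝓜 : ∀ x, (𝓜 x).PosSemidef) {ε : ℝ}
    (hε : 0 < ε) : ∃ c > 0, ∃ 𝓔 : Set (Set S), 𝓔.Finite ∧
      (∀ E ∈ 𝓔, MeasurableSet E ∧ μ.real E < ε) ∧
      ∀ v : EuclideanSpace ℝ (Fin p), ‖v‖ = 1 → ∃ E ∈ 𝓔, ∀ x ∉ E, c ≤ quadForm v (𝓜 x) := by
  have key (v : EuclideanSpace ℝ (Fin p)) : ∃ r > 0, ∃ E : Set S, v ≠ 0 →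
      MeasurableSet E ∧ μ.real E < ε ∧ ∀ w ∈ Metric.ball v r, ∀ x ∉ E, r ≤ quadForm w (𝓜 x) := by
    by_cases hv : v = 0
    · exact ⟨1, one_pos, ∅, fun h => (h hv).elim⟩
    · obtain ⟨r, hr, E, h⟩ := hM.exists_ball h𝓜 hv hε
      exact ⟨r, hr, E, fun _ => h⟩
  choose r hr E h using key
  obtain ⟨t, ht, hcov⟩ := (isCompact_sphere (0 : EuclideanSpace ℝ (Fin p)) 1).elim_nhds_subcover
    (fun v => Metric.ball v (r v)) fun v _ => Metric.ball_mem_nhds v (hr v)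
  have hne (v) (hv : v ∈ t) : v ≠ 0 := by
    rintro rfl
    simpa using ht 0 hv
  obtain ⟨c, hc, hct⟩ : ∃ c > 0, ∀ v ∈ t, c ≤ r v := by
    rcases t.eq_empty_or_nonempty with rfl | hte
    · exact ⟨1, one_pos, by simp⟩
    · obtain ⟨v, hv, hmin⟩ := t.exists_min_image r hte
      exact ⟨r v, hr v, hmin⟩
  refine ⟨c, hc, E '' t, t.finite_toSet.image E, ?_, fun v hv => ?_⟩
  · rintro _ ⟨v, hv, rfl⟩
    exact ⟨(h v (hne v hv)).1, (h v (hne v hv)).2.1⟩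
  · obtain ⟨w, hw, hvw⟩ := Set.mem_iUnion₂.1 (hcov (show v ∈ Metric.sphere 0 1 by simpa using hv))
    exact ⟨E w, ⟨w, hw, rfl⟩, fun x hx => (hct w hw).trans ((h w (hne w hw)).2.2 v hvw x hx)⟩

end Integral

/-! ### Strong law of large numbers along the data. -/

section Sampling

variable {S : Type*} [MeasurableSpace S] {μ : Measure S} {Ω : Type*} [MeasurableSpace Ω]
  {Pr : Measure Ω} {X : ℕ → Ω → S}

lemma ae_tendsto_sum_div (hXm : ∀ i, Measurable (X i)) (hXi : iIndepFun X Pr)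
    (hXd : ∀ i, Measure.map (X i) Pr = μ) {g : S → ℝ} (hgm : Measurable g)
    (hg : Integrable g μ) :
    ∀ᵐ ω ∂Pr, Tendsto (fun n : ℕ => (∑ i ∈ Finset.range n, g (X i ω)) / n) atTop
      (𝓝 (∫ x, g x ∂μ)) := by
  have hint : Integrable (g ∘ X 0) Pr := by
    refine Integrable.comp_measurable ?_ (hXm 0)
    rwa [hXd 0]
  have hid (i : ℕ) : IdentDistrib (g ∘ X i) (g ∘ X 0) Pr Pr :=
    IdentDistrib.comp ⟨(hXm i).aemeasurable, (hXm 0).aemeasurable, by rw [hXd, hXd]⟩ hgm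
  have h := strong_law_ae_real (fun i => g ∘ X i) hint
    (fun i j hij => (hXi.indepFun hij).comp hgm hgm) hid
  have heq : ∫ ω, (g ∘ X 0) ω ∂Pr = ∫ x, g x ∂μ := by
    rw [← hXd 0, integral_map (hXm 0).aemeasurable]
    · rfl
    · exact hgm.aestronglyMeasurable
  rw [heq] at h
  exact h

open Classical in
/-- Almost surely, the number of visits to a measurable set of measure less than `ε` is eventually
at most `ε k`. -/
lemma ae_eventually_card_le [IsFiniteMeasure μ] (hXm : ∀ i, Measurable (X i))
    (hXi : iIndepFun X Pr) (hXd : ∀ i, Measure.map (X i) Pr = μ) {E : Set S}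
    (hE : MeasurableSet E) {ε : ℝ} (hμ : μ.real E < ε) :
    ∀ᵐ ω ∂Pr, ∀ᶠ k : ℕ in atTop, (((Finset.range k).filter fun i => X i ω ∈ E).card : ℝ) ≤ ε * k := by
  have h := ae_tendsto_sum_div hXm hXi hXd (g := E.indicator 1) (measurable_one.indicator hE)
    ((integrable_const (1 : ℝ)).indicator hE)
  rw [integral_indicator_one hE] at h
  filter_upwards [h] with ω hω
  filter_upwards [hω.eventually_lt_const hμ, eventually_gt_atTop 0] with k hk hk0
  rw [div_lt_iff₀ (by exact_mod_cast hk0)] at hk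
  refine le_of_eq_of_le ?_ hk.le
  simp [Set.indicator_apply]

end Sampling

/-- Almost surely, every set of at least `ε k` indices below `k` carries information of order `k`
in every direction, for all large `k`. -/
lemma HypM.ae_eventually_le_sum {S : Type*} [TopologicalSpace S] [MeasurableSpace S]
    [OpensMeasurableSpace S] {p : ℕ} {μ : Measure S} [IsProbabilityMeasure μ]
    {𝓜 : S → Matrix (Fin p) (Fin p) ℝ} (hM : HypM μ 𝓜) (h𝓜 : ∀ x, (𝓜 x).PosSemidef)
    {Ω : Type*} [MeasurableSpace Ω] {Pr : Measure Ω} {X : ℕ → Ω → S}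
    (hXm : ∀ i, Measurable (X i)) (hXi : iIndepFun X Pr) (hXd : ∀ i, Measure.map (X i) Pr = μ)
    {ε : ℝ} (hε : 0 < ε) :
    ∃ c > 0, ∀ᵐ ω ∂Pr, ∀ᶠ k : ℕ in atTop, ∀ I ⊆ Finset.range k, ε * k ≤ (I.card : ℝ) →
      ∀ v : EuclideanSpace ℝ (Fin p), ‖v‖ = 1 →
        c * k ≤ quadForm v (∑ i ∈ I, 𝓜 (X i ω)) := by
  classical
  obtain ⟨c, hc, 𝓔, hfin, h𝓔, hcov⟩ := hM.exists_finite_cover h𝓜 (half_pos hε)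
  -- At most `ε k / 2` indices fall in the exceptional set of a direction; each of the others
  -- contributes at least `c`.
  refine ⟨ε / 2 * c, by positivity, ?_⟩
  have h := (ae_ball_iff hfin.countable).2 fun E hE =>
    ae_eventually_card_le hXm hXi hXd (h𝓔 E hE).1 (h𝓔 E hE).2
  filter_upwards [h] with ω hω
  filter_upwards [(eventually_all_finite hfin).2 hω] with k hk I hI hcard v hv
  obtain ⟨E, hE, hcE⟩ := hcov v hv
  set J := I.filter fun i => X i ω ∉ E
  have hsplit := Finset.card_filter_add_card_filter_not (s := I) fun i => X i ω ∈ E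
  have hsub : ((I.filter fun i => X i ω ∈ E).card : ℝ) ≤ ε / 2 * k :=
    le_trans (by exact_mod_cast Finset.card_le_card (Finset.filter_subset_filter _ hI)) (hk E hE)
  have hJ : ε / 2 * k ≤ (J.card : ℝ) := by
    have : ((I.filter fun i => X i ω ∈ E).card : ℝ) + (J.card : ℝ) = I.card := by
      exact_mod_cast hsplit
    linarith
  calc ε / 2 * c * k = ε / 2 * k * c := by ring
    _ ≤ J.card * c := by gcongr
    _ = ∑ i ∈ J, c := by simp
    _ ≤ ∑ i ∈ J, quadForm v (𝓜 (X i ω)) :=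
        Finset.sum_le_sum fun i hi => hcE _ (Finset.mem_filter.1 hi).2
    _ ≤ ∑ i ∈ I, quadForm v (𝓜 (X i ω)) :=
        Finset.sum_le_sum_of_subset_of_nonneg (Finset.filter_subset _ _)
          fun i _ _ => quadForm_nonneg (h𝓜 _) v
    _ = _ := (map_sum _ _ _).symm

lemma posDef_sum_range {S : Type*} {p : ℕ} {𝓜 : S → Matrix (Fin p) (Fin p) ℝ}
    (h𝓜 : ∀ x, (𝓜 x).PosSemidef) (x : ℕ → S) {k : ℕ} (h : IsUnit (meanInfo 𝓜 x k).det) :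
    (∑ i ∈ Finset.range k, 𝓜 (x i)).PosDef := by
  have hsum : (∑ i ∈ Finset.range k, 𝓜 (x i)).PosSemidef := posSemidef_sum _ fun i _ => h𝓜 _
  refine hsum.posDef_iff_isUnit.2 ((Matrix.isUnit_iff_isUnit_det _).2 ?_)
  rw [meanInfo, det_smul] at h
  exact (IsUnit.mul_iff.1 h).2

/-! ### Selection counts and the set of selected points. -/

section Algorithm

variable {S : Type*} {p : ℕ} {P : Params} {Φ : Matrix (Fin p) (Fin p) ℝ → WithBot ℝ}
  {𝓜 : S → Matrix (Fin p) (Fin p) ℝ} {x : ℕ → S}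

lemma startIndex_spec {K : ℕ} (h : startIndex P 𝓜 x = K) :
    P.k0 ≤ K ∧ IsUnit (meanInfo 𝓜 x K).det := by
  have hne : ((fun k : ℕ => (k : ℕ∞)) ''
      {k : ℕ | P.k0 ≤ k ∧ IsUnit (meanInfo 𝓜 x k).det}).Nonempty := by
    by_contra hempty
    rw [startIndex, Set.not_nonempty_iff_eq_empty.1 hempty, sInf_empty] at h
    exact ENat.top_ne_natCast K h
  obtain ⟨k, hk, hkK⟩ := csInf_mem hne
  have : k = K := by
    rw [← startIndex, h] at hkK
    simpa using hkK
  exact this ▸ hk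

lemma exists_startIndex_eq {k : ℕ} (hk : P.k0 ≤ k) (h : IsUnit (meanInfo 𝓜 x k).det) :
    ∃ K : ℕ, startIndex P 𝓜 x = K := by
  have hle : startIndex P 𝓜 x ≤ k := sInf_le ⟨k, ⟨hk, h⟩, rfl⟩
  exact ⟨_, (ENat.natCast_toNat (ne_top_of_le_ne_top (ENat.natCast_ne_top k) hle)).symm⟩

lemma state_of_le {k : ℕ} (h : (k : ℕ∞) ≤ startIndex P 𝓜 x) :
    state P Φ 𝓜 x k = initState P Φ 𝓜 x k := by
  cases k with
  | zero => rfl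
  | succ k => rw [state, if_pos h]

lemma state_succ_of_lt {k : ℕ} (h : startIndex P 𝓜 x < (k + 1 : ℕ)) :
    state P Φ 𝓜 x (k + 1) = step P Φ 𝓜 x k (state P Φ 𝓜 x k) := by
  rw [state, if_neg h.not_ge]

lemma state_n_of_le {k : ℕ} (h : (k : ℕ∞) ≤ startIndex P 𝓜 x) :
    (state P Φ 𝓜 x k).n = k := by
  rw [state_of_le h]; rfl

/-- The only information on the selection rule needed below: a rejection excludes `z = ⊤`, which
would pass any threshold. -/
lemma step_cases (k : ℕ) (s : State p) :
    ((step P Φ 𝓜 x k s).n = s.n + 1 ∧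
      (step P Φ 𝓜 x k s).M = s.M + (1 / ((s.n : ℝ) + 1)) • (𝓜 (x k) - s.M)) ∨
    (P.ε₁ ≤ (s.n : ℝ) / k ∧ (step P Φ 𝓜 x k s).n = s.n ∧ (step P Φ 𝓜 x k s).M = s.M) := by
  classical
  by_cases hz : (s.C : EReal) ≤ if (s.n : ℝ) / (k : ℝ) < P.ε₁ then ⊤ else
      ((dirDeriv Φ s.M (𝓜 (x k)) : ℝ) : EReal)
  · left
    simp only [step, if_pos hz, and_self]
  · right
    refine ⟨?_, ?_⟩
    · by_contra! hlt
      exact hz (by rw [if_pos hlt]; exact le_top)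
    · simp only [step, if_neg hz, and_self]

lemma state_n_eq_or (k : ℕ) :
    (state P Φ 𝓜 x (k + 1)).n = (state P Φ 𝓜 x k).n + 1 ∨
      (P.ε₁ ≤ ((state P Φ 𝓜 x k).n : ℝ) / k ∧
        (state P Φ 𝓜 x (k + 1)).n = (state P Φ 𝓜 x k).n) := by
  by_cases h : ((k + 1 : ℕ) : ℕ∞) ≤ startIndex P 𝓜 x
  · left
    rw [state_n_of_le h, state_n_of_le (le_trans (by exact_mod_cast k.le_succ) h)]
  · rw [state_succ_of_lt (not_le.1 h)]
    exact (step_cases k _).imp (·.1) fun h => ⟨h.1, h.2.1⟩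

/-- The factor is `k - 1` because the test that leads to `n_k` compares `n_{k-1}` with `k - 1`, and
a rejection keeps the count. A selection adds `1 ≥ ε₁`. -/
lemma mul_pred_le_state_n (h0 : 0 < P.ε₁) (h1 : P.ε₁ < 1) (k : ℕ) :
    P.ε₁ * ((k : ℝ) - 1) ≤ (state P Φ 𝓜 x k).n := by
  induction k with
  | zero =>
    have : (0 : ℝ) ≤ (state P Φ 𝓜 x 0).n := Nat.cast_nonneg _
    push_cast
    linarith
  | succ k ih =>
    rcases state_n_eq_or (P := P) (Φ := Φ) (𝓜 := 𝓜) (x := x) k with h | ⟨h, h'⟩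
    · rw [h]
      push_cast
      linarith
    · rw [h', Nat.cast_succ, add_sub_cancel_right]
      rcases k.eq_zero_or_pos with rfl | hk
      · simp
      · rwa [le_div_iff₀ (by exact_mod_cast hk)] at h

lemma lt_state_n_succ_div_of_eq_add_one (h0 : 0 < P.ε₁) (h1 : P.ε₁ < 1) {k : ℕ} (hk : 1 ≤ k)
    (h : (state P Φ 𝓜 x (k + 1)).n = (state P Φ 𝓜 x k).n + 1) :
    P.ε₁ < ((state P Φ 𝓜 x (k + 1)).n : ℝ) / k := by
  have := mul_pred_le_state_n (Φ := Φ) (𝓜 := 𝓜) (x := x) h0 h1 k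
  rw [lt_div_iff₀ (by exact_mod_cast hk), h]
  push_cast
  linarith

/-- The information matrix of the state is the average over the set of selected points, which
contains the initial sample. -/
lemma exists_selected (k : ℕ) : ∃ I ⊆ Finset.range k, I.card = (state P Φ 𝓜 x k).n ∧
    ((state P Φ 𝓜 x k).n : ℝ) • (state P Φ 𝓜 x k).M = ∑ i ∈ I, 𝓜 (x i) ∧
    ∀ i < k, ((i + 1 : ℕ) : ℕ∞) ≤ startIndex P 𝓜 x → i ∈ I := by
  have hinit (k : ℕ) : ((initState P Φ 𝓜 x k).n : ℝ) • (initState P Φ 𝓜 x k).M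
      = ∑ i ∈ Finset.range k, 𝓜 (x i) := by
    change (k : ℝ) • meanInfo 𝓜 x k = _
    rcases k.eq_zero_or_pos with rfl | hk
    · simp
    · have : (k : ℝ) ≠ 0 := by exact_mod_cast hk.ne'
      rw [meanInfo, smul_smul, mul_one_div_cancel this, one_smul]
  by_cases hle : (k : ℕ∞) ≤ startIndex P 𝓜 x
  · refine ⟨Finset.range k, subset_rfl, ?_, ?_, fun i hi _ => Finset.mem_range.2 hi⟩
    · rw [state_n_of_le hle, Finset.card_range]
    · rw [state_of_le hle, hinit]
  induction k with
  | zero => simp at hle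
  | succ k ih =>
    -- `state k` may still belong to the initialization, where `ih` is vacuous.
    have ih' : ∃ I ⊆ Finset.range k, I.card = (state P Φ 𝓜 x k).n ∧
        ((state P Φ 𝓜 x k).n : ℝ) • (state P Φ 𝓜 x k).M = ∑ i ∈ I, 𝓜 (x i) ∧
        ∀ i < k, ((i + 1 : ℕ) : ℕ∞) ≤ startIndex P 𝓜 x → i ∈ I := by
      by_cases hk : (k : ℕ∞) ≤ startIndex P 𝓜 x
      · refine ⟨Finset.range k, subset_rfl, ?_, ?_, fun i hi _ => Finset.mem_range.2 hi⟩
        · rw [state_n_of_le hk, Finset.card_range]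
        · rw [state_of_le hk, hinit]
      · exact ih hk
    obtain ⟨I, hI, hcard, hsum, hmem⟩ := ih'
    have hinitial (i : ℕ) (hi : i < k + 1) (h : ((i + 1 : ℕ) : ℕ∞) ≤ startIndex P 𝓜 x) : i ∈ I := by
      rcases Nat.lt_succ_iff_lt_or_eq.1 hi with hi | rfl
      · exact hmem i hi h
      · exact (hle h).elim
    rw [state_succ_of_lt (not_le.1 hle)]
    rcases step_cases (P := P) (Φ := Φ) (𝓜 := 𝓜) (x := x) k (state P Φ 𝓜 x k) with
      ⟨hn, hM⟩ | ⟨-, hn, hM⟩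
    · have hk : k ∉ I := fun h => by simpa using hI h
      refine ⟨insert k I, ?_, ?_, ?_, fun i hi h => Finset.mem_insert_of_mem (hinitial i hi h)⟩
      · rw [Finset.range_add_one]
        exact Finset.insert_subset_insert k hI
      · rw [Finset.card_insert_of_notMem hk, hcard, hn]
      -- The recursion reads `(n + 1) M' = n M + 𝓜 (x k)`.
      · have hne : ((state P Φ 𝓜 x k).n : ℝ) + 1 ≠ 0 := by positivity
        rw [Finset.sum_insert hk, ← hsum, hn, hM, Nat.cast_succ, smul_add, smul_smul,
          mul_one_div_cancel hne, one_smul, add_smul, one_smul]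
        abel
    · refine ⟨I, hI.trans (Finset.range_subset_range.2 k.le_succ), ?_, ?_, hinitial⟩
      · rw [hcard, hn]
      · rw [hn, hM, hsum]

end Algorithm

/-- Only finitely many indices precede the eventual bound, and their minimum is positive; halving
makes the inequality strict. -/
lemma exists_pos_lt_of_eventually_le {f : ℕ → ℝ} {K : ℕ} (hf : ∀ k, K < k → 0 < f k) {c : ℝ}
    (hc : 0 < c) (h : ∀ᶠ k in atTop, c ≤ f k) : ∃ l > 0, ∀ k, K < k → l < f k := by
  obtain ⟨N, hN⟩ := eventually_atTop.1 h
  obtain ⟨b, hb, hbN⟩ : ∃ b > 0, ∀ k ∈ Finset.Ioo K N, b ≤ f k := by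
    rcases (Finset.Ioo K N).eq_empty_or_nonempty with he | hne
    · exact ⟨1, one_pos, by simp [he]⟩
    · obtain ⟨m, hm, hmin⟩ := (Finset.Ioo K N).exists_min_image f hne
      exact ⟨f m, hf m (Finset.mem_Ioo.1 hm).1, hmin⟩
  refine ⟨min b c / 2, by positivity, fun k hk => ?_⟩
  refine (half_lt_self (lt_min hb hc)).trans_le ?_
  rcases lt_or_ge k N with hkN | hkN
  · exact (min_le_left _ _).trans (hbN k (Finset.mem_Ioo.2 ⟨hk, hkN⟩))
  · exact (min_le_right _ _).trans (hN k hkN)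

/-! ### Deterministic bounds along one realization. -/

section Path

variable {S : Type*} {p : ℕ} {P : Params} {Φ : Matrix (Fin p) (Fin p) ℝ → WithBot ℝ}
  {𝓜 : S → Matrix (Fin p) (Fin p) ℝ} {x : ℕ → S}

/-- The selected sum is the initial one, positive definite by the stopping rule, plus positive
semidefinite terms. -/
lemma state_M_posDef (h𝓜 : ∀ x, (𝓜 x).PosSemidef) {K : ℕ} (hK : startIndex P 𝓜 x = K)
    (hK0 : 0 < K) {k : ℕ} (hk : K < k) :
    0 < (state P Φ 𝓜 x k).n ∧ (state P Φ 𝓜 x k).M.PosDef := by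
  obtain ⟨I, -, hcard, hsum, hmem⟩ := exists_selected (P := P) (Φ := Φ) (𝓜 := 𝓜) (x := x) k
  have hsub : Finset.range K ⊆ I := fun i hi => by
    have hi := Finset.mem_range.1 hi
    exact hmem i (hi.trans hk) (by rw [hK]; exact_mod_cast hi)
  have hn : 0 < (state P Φ 𝓜 x k).n := by
    have := Finset.card_le_card hsub
    rw [Finset.card_range] at this
    omega
  refine ⟨hn, ?_⟩
  have hn' : (0 : ℝ) < (state P Φ 𝓜 x k).n := by exact_mod_cast hn
  have hpd : (∑ i ∈ I, 𝓜 (x i)).PosDef := by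
    rw [← Finset.sum_sdiff hsub]
    exact PosDef.posSemidef_add (posSemidef_sum _ fun i _ => h𝓜 _)
      (posDef_sum_range h𝓜 x (startIndex_spec hK).2)
  have := hpd.smul (inv_pos.2 hn')
  rwa [← hsum, inv_smul_smul₀ hn'.ne'] at this

lemma half_mul_le_state_n (h0 : 0 < P.ε₁) (h1 : P.ε₁ < 1) {k : ℕ} (hk : 2 ≤ k) :
    P.ε₁ / 2 * k ≤ (state P Φ 𝓜 x k).n := by
  refine le_trans ?_ (mul_pred_le_state_n h0 h1 k)
  have : (2 : ℝ) ≤ k := by exact_mod_cast hk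
  nlinarith

lemma trace_state_M_le (h𝓜 : ∀ x, (𝓜 x).PosSemidef) (h0 : 0 < P.ε₁) (h1 : P.ε₁ < 1) {T : ℝ}
    (hT : ∀ k : ℕ, (∑ i ∈ Finset.range k, (𝓜 (x i)).trace) / k ≤ T) {k : ℕ} (hk : 2 ≤ k) :
    (state P Φ 𝓜 x k).M.trace ≤ T / (P.ε₁ / 2) := by
  obtain ⟨I, hI, -, hsum, -⟩ := exists_selected (P := P) (Φ := Φ) (𝓜 := 𝓜) (x := x) k
  have hk0 : (0 : ℝ) < k := by exact_mod_cast (by omega : 0 < k)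
  have hn := half_mul_le_state_n (Φ := Φ) (𝓜 := 𝓜) (x := x) h0 h1 hk
  have hn0 : (0 : ℝ) < (state P Φ 𝓜 x k).n := lt_of_lt_of_le (by positivity) hn
  have htr : ((state P Φ 𝓜 x k).n : ℝ) * (state P Φ 𝓜 x k).M.trace ≤ T * k := by
    rw [← smul_eq_mul, ← trace_smul, hsum, trace_sum]
    exact (Finset.sum_le_sum_of_subset_of_nonneg hI fun i _ _ => (h𝓜 _).trace_nonneg).trans
      ((div_le_iff₀ hk0).1 (hT k))
  -- At `k = 0` the average is `0 / 0 = 0`.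
  have hT0 : 0 ≤ T := by simpa using hT 0
  calc (state P Φ 𝓜 x k).M.trace ≤ T * k / (state P Φ 𝓜 x k).n := by
        rwa [le_div_iff₀ hn0, mul_comm]
    _ ≤ T * k / (P.ε₁ / 2 * k) := by gcongr
    _ = T / (P.ε₁ / 2) := mul_div_mul_right _ _ hk0.ne'

/-- The sum over selected points is `n M`, with form at least `c k`; since `n ≤ k`, dividing by `n`
keeps the constant `c`. -/
lemma eventually_le_lambdaMin_state [NeZero p] (h𝓜 : ∀ x, (𝓜 x).PosSemidef) (h0 : 0 < P.ε₁)
    (h1 : P.ε₁ < 1) {K : ℕ} (hK : startIndex P 𝓜 x = K) (hK0 : 0 < K) {c : ℝ} (hc : 0 < c)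
    (h : ∀ᶠ k : ℕ in atTop, ∀ I ⊆ Finset.range k, P.ε₁ / 2 * k ≤ (I.card : ℝ) →
      ∀ v : EuclideanSpace ℝ (Fin p), ‖v‖ = 1 → c * k ≤ quadForm v (∑ i ∈ I, 𝓜 (x i))) :
    ∀ᶠ k : ℕ in atTop, c ≤ lambdaMin (state P Φ 𝓜 x k).M := by
  filter_upwards [h, eventually_ge_atTop 2, eventually_gt_atTop K] with k hk hk2 hkK
  obtain ⟨hn, hpd⟩ := state_M_posDef (Φ := Φ) h𝓜 hK hK0 hkK
  obtain ⟨I, hI, hcard, hsum, -⟩ := exists_selected (P := P) (Φ := Φ) (𝓜 := 𝓜) (x := x) k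
  refine le_lambdaMin hpd.1 fun v hv => ?_
  have hq := hk I hI (by rw [hcard]; exact half_mul_le_state_n h0 h1 hk2) v hv
  rw [← hsum, map_smul, smul_eq_mul] at hq
  have hn' : (0 : ℝ) < (state P Φ 𝓜 x k).n := by exact_mod_cast hn
  have hnk : ((state P Φ 𝓜 x k).n : ℝ) ≤ k := by
    rw [← hcard]
    exact_mod_cast (Finset.card_le_card hI).trans_eq (Finset.card_range k)
  refine le_of_mul_le_mul_left (le_trans ?_ hq) hn'
  rw [mul_comm c]
  gcongr

/-- The full index set is large enough for the hypothesis, so the average over all points is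
eventually nonsingular. -/
lemma exists_startIndex_of_eventually_le (h1 : P.ε₁ < 1)
    (h𝓜 : ∀ x, (𝓜 x).PosSemidef) {c : ℝ} (hc : 0 < c)
    (h : ∀ᶠ k : ℕ in atTop, ∀ I ⊆ Finset.range k, P.ε₁ / 2 * k ≤ (I.card : ℝ) →
      ∀ v : EuclideanSpace ℝ (Fin p), ‖v‖ = 1 → c * k ≤ quadForm v (∑ i ∈ I, 𝓜 (x i))) :
    ∃ K : ℕ, startIndex P 𝓜 x = K := by
  obtain ⟨k, hk, hk0, hkP⟩ :=
    (h.and ((eventually_gt_atTop 0).and (eventually_ge_atTop P.k0))).exists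
  have hk' : (0 : ℝ) < k := by exact_mod_cast hk0
  have hpd : (∑ i ∈ Finset.range k, 𝓜 (x i)).PosDef :=
    posDef_of_quadForm_pos (posSemidef_sum _ fun i _ => h𝓜 _).1 fun v hv =>
      lt_of_lt_of_le (by positivity) (hk _ subset_rfl (by
        rw [Finset.card_range]
        nlinarith) v hv)
  exact exists_startIndex_eq hkP
    (isUnit_iff_ne_zero.2 (hpd.smul (one_div_pos.2 hk')).det_pos.ne')

end Path

end SeqDesign

theorem mainTheorem7 {d p : ℕ} (hp : 1 < p) (𝒳 : Set (EuclideanSpace ℝ (Fin d)))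
    (μ : Measure 𝒳) [IsProbabilityMeasure μ]
    (𝓜 : 𝒳 → Matrix (Fin p) (Fin p) ℝ) (h𝓜 : ∀ x, (𝓜 x).PosSemidef)
    (hM : SeqDesign.HypM μ 𝓜)
    (Φ : Matrix (Fin p) (Fin p) ℝ → WithBot ℝ)
    (P : SeqDesign.Params) (hP : P.Valid p)
    {Ω : Type*} [MeasurableSpace Ω] (Pr : Measure Ω) [IsProbabilityMeasure Pr]
    (X : ℕ → Ω → 𝒳) (hXm : ∀ i, Measurable (X i)) (hXi : iIndepFun X Pr)
    (hXd : ∀ i, Measure.map (X i) Pr = μ) :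
    (∀ ω : Ω, ∀ k : ℕ, 1 ≤ k →
      P.ε₁ ≤ ((SeqDesign.state P Φ 𝓜 (fun i => X i ω) (k + 1)).n : ℝ) / (k : ℝ) ∧
      (¬(((SeqDesign.state P Φ 𝓜 (fun i => X i ω) k).n : ℝ) / (k : ℝ) = P.ε₁ ∧
          (SeqDesign.state P Φ 𝓜 (fun i => X i ω) (k + 1)).n =
            (SeqDesign.state P Φ 𝓜 (fun i => X i ω) k).n) →
        P.ε₁ < ((SeqDesign.state P Φ 𝓜 (fun i => X i ω) (k + 1)).n : ℝ) / (k : ℝ))) ∧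
    (∀ᵐ ω ∂Pr, ∃ K : ℕ, SeqDesign.startIndex P 𝓜 (fun i => X i ω) = (K : ℕ∞) ∧
      ∃ l : ℝ, 0 < l ∧ ∃ L : ℝ, ∀ k : ℕ, K < k →
        (SeqDesign.state P Φ 𝓜 (fun i => X i ω) k).M ∈ SeqDesign.boundedCone p l L) := by
  have h0 := hP.ε₁_pos
  have h1 := hP.ε₁_lt.trans hP.α_lt_one
  have : NeZero p := ⟨by omega⟩
  refine ⟨fun ω k hk => ?_, ?_⟩
  · rcases SeqDesign.state_n_eq_or (P := P) (Φ := Φ) (𝓜 := 𝓜) (x := fun i => X i ω) k with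
      h | ⟨h, h'⟩
    · have hlt := SeqDesign.lt_state_n_succ_div_of_eq_add_one h0 h1 hk h
      exact ⟨hlt.le, fun _ => hlt⟩
    · rw [h']
      exact ⟨h, fun hne => h.lt_of_ne fun he => hne ⟨he.symm, rfl⟩⟩
  · obtain ⟨c, hc, hlow⟩ := hM.ae_eventually_le_sum h𝓜 hXm hXi hXd (half_pos h0)
    have htrm : Measurable fun x => (𝓜 x).trace := by
      have := hM.cont
      exact (by fun_prop : Continuous fun x => (𝓜 x).trace).measurable
    filter_upwards [hlow, SeqDesign.ae_tendsto_sum_div hXm hXi hXd htrm hM.integrable_trace]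
      with ω hω htr
    obtain ⟨K, hK⟩ := SeqDesign.exists_startIndex_of_eventually_le h1 h𝓜 hc hω
    -- From `K ≥ k0 ≥ p ≥ 2`: the initial sample is nonempty, and the bounds requiring `2 ≤ k` hold
    -- for all `k > K`.
    have hK2 : 2 ≤ K := hp.trans_le (hP.k0_ge.trans (SeqDesign.startIndex_spec hK).1)
    have hpd {k : ℕ} (hk : K < k) :=
      (SeqDesign.state_M_posDef (Φ := Φ) h𝓜 hK (by omega) hk).2
    obtain ⟨T, hT⟩ := htr.bddAbove_range
    obtain ⟨l, hl, hlk⟩ := SeqDesign.exists_pos_lt_of_eventually_le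
      (fun k hk => SeqDesign.lambdaMin_pos (hpd hk)) hc
      (SeqDesign.eventually_le_lambdaMin_state h𝓜 h0 h1 hK (by omega) hc hω)
    refine ⟨K, hK, l, hl, T / (P.ε₁ / 2) + 1, fun k hk => ⟨(hpd hk).posSemidef, hlk k hk, ?_⟩⟩
    refine (SeqDesign.lambdaMax_le_trace (hpd hk).posSemidef).trans_lt (lt_of_le_of_lt ?_
      (lt_add_one _))
    exact SeqDesign.trace_state_M_le h𝓜 h0 h1 (fun n => hT ⟨n, rfl⟩) (by omega)
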